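/- Let $n \ge 3$ and let $V$ be a set of $n$ vertices. A Bayesian network on $V$ is a directed acyclic graph with vertex set $V$; its skeleton is its underlying undirected graph. A graph on $V$ is a chain if, for some ordering $v_1,\dots,v_n$ of $V$, its edges are exactly $\{v_1,v_2\},\{v_2,v_3\},\dots,\{v_{n-1},v_n\}$. Two Bayesian networks on $V$ are Markov equivalent if for all distinct $u,v\in V$ and all $Z\subseteq V\setminus\{u,v\}$, $Z$ d-separates $u$ and $v$ in one exactly when it does so in the other. The d-separation distance $d(D_1,D_2)$ is the number of pairs $(\{u,v\},Z)$ with $u\ne v$ in $V$ and $Z\subseteq V\setminus\{u,v\}$ such that $u$ and $v$ are d-separated by $Z$ in exactly one of $D_1$ and $D_2$. Let $D$ be a Bayesian network on $V$ whose skeleton is a chain. Then $$\min\{\, d(D,D') : D' \text{ a Bayesian network on } V \text{ whose skeleton is a chain and which is not Markov equivalent to } D \,\} = 2^{n-1}-2 .$$ (In particular the set is non-empty and the minimum is attained.) Moreover, for each ordering $v_1,\dots,v_n$ of $V$ along which the skeleton of $D$ is a chain, the minimum is attained by a Bayesian network $D'$, not Markov equivalent to $D$, whose skeleton is the chain obtained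 by swapping $v_1$ and $v_2$, that is, the chain along $v_2,v_1,v_3,\dots,v_n$, and whose set of colliders (vertices with at least two incoming arcs) is that of $D$ with $v_2$ removed, if it belongs to it. -/

import Mathlib

/-- A Bayesian network structure on the vertex set `V`: a directed acyclic graph. -/
structure BayesNet (V : Type*) where
  /-- `Arc u v` says that `(u, v)` is an arc. -/
  Arc : V → V → Prop
  acyclic : ∀ v, ¬ Relation.TransGen Arc v v

namespace BayesNet

/-- The underlying undirected graph. -/
def skeleton {V : Type*} (D : BayesNet V) : SimpleGraph V where
  Adj u v := D.Arc u v ∨ D.Arc v u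
  symm := ⟨fun _ _ h => h.symm⟩
  loopless := ⟨fun v h => D.acyclic v (Relation.TransGen.single (h.elim id id))⟩

/-- The `i`-th vertex (counting from `0`) of the walk `p` has both incident edges of the walk
pointing towards it. Used for internal vertices, `0 < i < p.length`. -/
def ColliderOn {V : Type*} (D : BayesNet V) {u v : V} (p : D.skeleton.Walk u v) (i : ℕ) : Prop :=
  D.Arc (p.getVert (i - 1)) (p.getVert i) ∧ D.Arc (p.getVert (i + 1)) (p.getVert i)

/-- `S` d-separates `u` and `v`: every path between them has an internal vertex that is either
a non-collider in `S`, or a collider such that neither it nor any of its descendants is in `S`. -/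
def DSep {V : Type*} (D : BayesNet V) (u v : V) (S : Set V) : Prop :=
  ∀ p : D.skeleton.Walk u v, p.IsPath → ∃ i, 0 < i ∧ i < p.length ∧
    ((¬ D.ColliderOn p i ∧ p.getVert i ∈ S) ∨
      (D.ColliderOn p i ∧ p.getVert i ∉ S ∧
        ∀ w, Relation.TransGen D.Arc (p.getVert i) w → w ∉ S))

/-- Two Bayesian networks are Markov equivalent when they encode the same conditional
independencies. -/
def MarkovEquiv {V : Type*} (D₁ D₂ : BayesNet V) : Prop :=
  ∀ (u v : V) (S : Set V), u ≠ v → u ∉ S → v ∉ S → (D₁.DSep u v S ↔ D₂.DSep u v S)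

/-- The d-separation distance: the number of triples `(i, j, Z)` with `i < j` and
`Z ⊆ V \ {i, j}` such that `Z` d-separates `i` and `j` in exactly one of the two networks. -/
noncomputable def dist {n : ℕ} (D₁ D₂ : BayesNet (Fin n)) : ℕ :=
  Set.ncard {t : Fin n × Fin n × Finset (Fin n) |
    t.1 < t.2.1 ∧ t.1 ∉ t.2.2 ∧ t.2.1 ∉ t.2.2 ∧
      ¬ (D₁.DSep t.1 t.2.1 (t.2.2 : Set (Fin n)) ↔ D₂.DSep t.1 t.2.1 (t.2.2 : Set (Fin n)))}

/-- `D'` is not Markov equivalent to `D` and its skeleton belongs to the family `F`. -/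
def IsCandidate {n : ℕ} (F : Set (SimpleGraph (Fin n))) (D D' : BayesNet (Fin n)) : Prop :=
  ¬ D'.MarkovEquiv D ∧ D'.skeleton ∈ F

/-- `Dc` is a closest Bayesian network to `D` in the family `F`. -/
def IsClosest {n : ℕ} (F : Set (SimpleGraph (Fin n))) (D Dc : BayesNet (Fin n)) : Prop :=
  IsCandidate F D Dc ∧ ∀ D', IsCandidate F D D' → D.dist Dc ≤ D.dist D'

/-- The vertices with arcs coming in from two distinct vertices. -/
def colliders {V : Type*} (D : BayesNet V) : Set V :=
  {v | ∃ u w, u ≠ w ∧ D.Arc u v ∧ D.Arc w v}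

end BayesNet

/-- `G` is the chain `σ 0 - σ 1 - ⋯ - σ (n - 1)`. -/
def IsChainAlong {n : ℕ} (G : SimpleGraph (Fin n)) (σ : Equiv.Perm (Fin n)) : Prop :=
  ∀ i j : Fin n, G.Adj (σ i) (σ j) ↔ ((i : ℕ) + 1 = j ∨ (j : ℕ) + 1 = i)

/-- The family of all chains on the vertex set `Fin n`. -/
def chains (n : ℕ) : Set (SimpleGraph (Fin n)) :=
  {G | ∃ σ : Equiv.Perm (Fin n), IsChainAlong G σ}

/-!
In a network whose skeleton is a chain there is one path between two vertices `u` and `v`, and a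
collider, being the head of both arcs at it, has no descendants. Hence `S` fails to d-separate
`u` and `v` exactly when `S` coincides with the set of colliders strictly between them
(`BayesNet.dSep_iff`). Together with `u, v ∉ S` this prescribes the trace of `S` on the vertex set
`J` of the path, so the sets connecting `u` and `v` form a subcube of cardinality
`2 ^ (n - |J|)`, and the distance of two networks is the sum, over all pairs `{u, v}`, of the
cardinality of the symmetric difference of two such subcubes
(`BayesNet.dist_eq_pairSum`, `BayesNet.pairDist_add_inter`).

The lower bound `BayesNet.two_pow_le_dist` distinguishes how many edges of one skeleton are missing
from the other; the number is the same both ways, since chains have equally many edges.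

* None: the networks differ at some collider, and for every pair `{u, v}` with that vertex strictly
  between them the two subcubes are disjoint. The terms of such pairs already reach the bound
  (`BayesNet.two_pow_le_dist_of_skeleton_eq`).
* At least two: each of the at least four pairs adjacent in one network only contributes
  `2 ^ (n - 3)` or more (`BayesNet.two_pow_le_dist_of_two_le_card_edgeDiff`).
* One: removing the edge leaves two blocks, which both orderings traverse monotonically. Up to
  reversal of the orderings, the second chain reverses either an initial block of the first
  (`BayesNet.two_pow_le_dist_of_reversed_prefix`) or both blocks, which makes it a cyclic shift
  (`BayesNet.two_pow_le_dist_of_rotation`). Two or three pairs give the bound, except when only an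
  initial block of two vertices is reversed, where all pairs joining it to the rest are used.

The bound is attained in the last case. `BayesNet.transportTail` keeps all arcs except those at the
first two vertices, exchanges these two, and orients the first edge so that no collider arises at
its ends. Then only the pairs of one of the first two vertices with a later one contribute; for the
`j`-th vertex (counting from `0`) both terms are `2 ^ (n - j - 1)`, because one subcube lies in the
other (`BayesNet.dist_eq_of_swap`).
-/

/-! ### Paths in chains -/

/-- An integer sequence with steps `±1` that never turns back is monotone with slope `±1`. -/
theorem eq_add_or_eq_sub_of_unit_steps (b : ℕ → ℤ) (L : ℕ)
    (hstep : ∀ t < L, b (t + 1) = b t + 1 ∨ b (t + 1) = b t - 1)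
    (hturn : ∀ t, t + 2 ≤ L → b (t + 2) ≠ b t) :
    (∀ t ≤ L, b t = b 0 + t) ∨ (∀ t ≤ L, b t = b 0 - t) := by
  induction L with
  | zero => left; intro t ht; obtain rfl : t = 0 := by omega
            simp
  | succ L ih =>
    have hL := hstep L (by omega)
    have ext : ∀ c : ℤ, (∀ t ≤ L, b t = b 0 + c * t) → b (L + 1) = b 0 + c * (L + 1 : ℕ) →
        ∀ t ≤ L + 1, b t = b 0 + c * t := by
      intro c h h' t ht
      rcases Nat.lt_or_ge L t with h1 | h1
      · obtain rfl : t = L + 1 := by omega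
        exact h'
      · exact h t h1
    have ext1 := ext 1
    have ext2 := ext (-1)
    simp only [one_mul, neg_one_mul, ← sub_eq_add_neg] at ext1 ext2
    rcases Nat.eq_zero_or_pos L with rfl | hpos
    · simp only [Nat.zero_add] at *
      rcases hL with h | h
      · left
        exact ext1 (fun t ht => by obtain rfl : t = 0 := by omega
                                   simp) (by simpa using h)
      · right
        exact ext2 (fun t ht => by obtain rfl : t = 0 := by omega
                                   simp) (by simpa using h)
    · have h2 := hturn (L - 1) (by omega)
      rw [show L - 1 + 2 = L + 1 by omega] at h2
      rcases ih (fun t ht => hstep t (by omega)) (fun t ht => hturn t (by omega)) with h | h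
      · left
        have h3 := h L le_rfl
        have h4 := h (L - 1) (by omega)
        exact ext1 h (by push_cast; omega)
      · right
        have h3 := h L le_rfl
        have h4 := h (L - 1) (by omega)
        exact ext2 h (by push_cast; omega)

namespace IsChainAlong

variable {n : ℕ} {G : SimpleGraph (Fin n)} {σ : Equiv.Perm (Fin n)}

theorem adj_iff (h : IsChainAlong G σ) (u v : Fin n) :
    G.Adj u v ↔ ((σ.symm u : ℕ) + 1 = σ.symm v ∨ (σ.symm v : ℕ) + 1 = σ.symm u) := by
  simpa using h (σ.symm u) (σ.symm v)

theorem preconnected (h : IsChainAlong G σ) : G.Preconnected := by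
  have key : ∀ (m : ℕ) (i j : Fin n), (i : ℕ) + m = j → G.Reachable (σ i) (σ j) := by
    intro m
    induction m with
    | zero => intro i j hij
              obtain rfl : i = j := Fin.ext (by omega)
              exact SimpleGraph.Reachable.refl _
    | succ m ih =>
      intro i j hij
      have hj := j.isLt
      refine (ih i ⟨i + m, by omega⟩ rfl).trans (SimpleGraph.Adj.reachable ?_)
      rw [h]
      left
      simp only
      omega
  intro u v
  rcases le_total (σ.symm u) (σ.symm v) with huv | huv
  · simpa using key (σ.symm v - σ.symm u : ℕ) (σ.symm u) (σ.symm v)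
      (by rw [Fin.le_def] at huv; omega)
  · simpa using (key (σ.symm u - σ.symm v : ℕ) (σ.symm v) (σ.symm u)
      (by rw [Fin.le_def] at huv; omega)).symm

/-- A path in a chain runs monotonically through the positions. -/
theorem pos_getVert (h : IsChainAlong G σ) {u v : Fin n} (p : G.Walk u v) (hp : p.IsPath) :
    (∀ t ≤ p.length, (σ.symm (p.getVert t) : ℤ) = σ.symm u + t) ∨
    (∀ t ≤ p.length, (σ.symm (p.getVert t) : ℤ) = σ.symm u - t) := by
  have := eq_add_or_eq_sub_of_unit_steps (fun t => (σ.symm (p.getVert t) : ℤ)) p.length ?_ ?_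
  · simpa using this
  · intro t ht
    have := (h.adj_iff _ _).1 (p.adj_getVert_succ ht)
    omega
  · intro t ht heq
    have heq' : p.getVert (t + 2) = p.getVert t := by
      apply σ.symm.injective
      apply Fin.ext
      simpa using heq
    have := hp.getVert_injOn (by simpa using ht) (by simp only [Set.mem_ofPred_eq]; omega) heq'
    omega

/-- A chain may be read backwards. -/
theorem rev (h : IsChainAlong G σ) : IsChainAlong G (Fin.revPerm.trans σ) := by
  intro i j
  simp only [Equiv.trans_apply, Fin.revPerm_apply]
  rw [h, Fin.val_rev, Fin.val_rev]
  omega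

end IsChainAlong

theorem val_symm_rev_trans {n : ℕ} (σ : Equiv.Perm (Fin n)) (x : Fin n) :
    (((Fin.revPerm.trans σ).symm x : Fin n) : ℕ) = n - 1 - σ.symm x := by
  rw [Equiv.symm_trans_apply, Fin.revPerm_symm, Fin.revPerm_apply, Fin.val_rev]
  omega

/-- The vertices of the path from `u` to `v`, end points included, in the chain along `σ`. -/
def pathSupport {n : ℕ} (σ : Equiv.Perm (Fin n)) (u v : Fin n) : Finset (Fin n) :=
  (Finset.uIcc (σ.symm u) (σ.symm v)).map σ.toEmbedding

section pathSupport

variable {n : ℕ} {σ : Equiv.Perm (Fin n)}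

theorem mem_pathSupport {u v w : Fin n} : w ∈ pathSupport σ u v ↔
    ((σ.symm u : ℕ) ≤ σ.symm w ∧ (σ.symm w : ℕ) ≤ σ.symm v) ∨
      ((σ.symm v : ℕ) ≤ σ.symm w ∧ (σ.symm w : ℕ) ≤ σ.symm u) := by
  simp only [pathSupport, Finset.mem_map_equiv, Finset.mem_uIcc', Fin.le_def]

theorem card_pathSupport (u v : Fin n) :
    (pathSupport σ u v).card = ((σ.symm v : ℤ) - σ.symm u).natAbs + 1 := by
  rw [pathSupport, Finset.card_map, Fin.card_uIcc]

theorem pathSupport_comm (u v : Fin n) : pathSupport σ u v = pathSupport σ v u := by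
  rw [pathSupport, pathSupport, Finset.uIcc_comm]

theorem left_mem_pathSupport (u v : Fin n) : u ∈ pathSupport σ u v := by
  rw [mem_pathSupport]; omega

theorem right_mem_pathSupport (u v : Fin n) : v ∈ pathSupport σ u v := by
  rw [mem_pathSupport]; omega

end pathSupport

/-! ### D-separation in chains -/

namespace BayesNet

variable {n : ℕ} {D : BayesNet (Fin n)} {σ : Equiv.Perm (Fin n)}

theorem exists_getVert_iff (h : IsChainAlong D.skeleton σ) {u v : Fin n}
    (p : D.skeleton.Walk u v) (hp : p.IsPath) (w : Fin n) :
    (∃ i, 0 < i ∧ i < p.length ∧ p.getVert i = w) ↔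
      w ∈ pathSupport σ u v ∧ w ≠ u ∧ w ≠ v := by
  have hlen := p.getVert_length
  have hext : ∀ x y : Fin n, (σ.symm x : ℤ) = σ.symm y → x = y := fun x y hxy =>
    σ.symm.injective (Fin.ext (by exact_mod_cast hxy))
  have hne : ∀ x y : Fin n, (σ.symm x : ℤ) ≠ σ.symm y → x ≠ y := by
    rintro x y hxy rfl; exact hxy rfl
  have hne' : ∀ x y : Fin n, x ≠ y → (σ.symm x : ℤ) ≠ σ.symm y := fun x y hxy h' =>
    hxy (hext x y h')
  rw [mem_pathSupport]
  rcases h.pos_getVert p hp with hp' | hp'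
  all_goals
    have h1 := hp' p.length le_rfl
    rw [hlen] at h1
    constructor
    · rintro ⟨i, hi0, hi, rfl⟩
      have h2 := hp' i hi.le
      exact ⟨by omega, hne _ _ (by omega), hne _ _ (by omega)⟩
    · rintro ⟨h2, h3, h4⟩
      have h3 := hne' _ _ h3
      have h4 := hne' _ _ h4
      refine ⟨((σ.symm w : ℤ) - σ.symm u).natAbs, by omega, by omega, hext _ _ ?_⟩
      rw [hp' _ (by omega)]
      omega

theorem arc_adj {u v : Fin n} (h : D.Arc u v) : D.skeleton.Adj u v := Or.inl h

theorem not_arc_symm {u v : Fin n} (h : D.Arc u v) : ¬ D.Arc v u := fun h' =>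
  D.acyclic u ((Relation.TransGen.single h).tail h')

/-- A collider of a chain is the head of both arcs at it. -/
theorem arc_of_mem_colliders (h : IsChainAlong D.skeleton σ) {v x : Fin n}
    (hv : v ∈ D.colliders) (hx : D.skeleton.Adj x v) : D.Arc x v := by
  obtain ⟨u, w, huw, hu, hw⟩ := hv
  have h1 := (h.adj_iff _ _).1 (arc_adj hu)
  have h2 := (h.adj_iff _ _).1 (arc_adj hw)
  have h3 := (h.adj_iff _ _).1 hx
  have h4 : (σ.symm u : ℕ) ≠ σ.symm w := fun h' => huw (σ.symm.injective (Fin.ext h'))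
  rcases (by omega : (σ.symm x : ℕ) = σ.symm u ∨ (σ.symm x : ℕ) = σ.symm w) with h5 | h5
  · rw [σ.symm.injective (Fin.ext h5)]; exact hu
  · rw [σ.symm.injective (Fin.ext h5)]; exact hw

theorem colliderOn_iff (h : IsChainAlong D.skeleton σ) {u v : Fin n}
    (p : D.skeleton.Walk u v) (hp : p.IsPath) {i : ℕ} (hi0 : 0 < i) (hi : i < p.length) :
    D.ColliderOn p i ↔ p.getVert i ∈ D.colliders := by
  constructor
  · rintro ⟨h1, h2⟩
    refine ⟨_, _, fun heq => ?_, h1, h2⟩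
    have := hp.getVert_injOn (by simp only [Set.mem_ofPred_eq]; omega)
      (by simp only [Set.mem_ofPred_eq]; omega) heq
    omega
  · intro hc
    have h1 := p.adj_getVert_succ (i := i - 1) (by omega)
    rw [show i - 1 + 1 = i by omega] at h1
    exact ⟨arc_of_mem_colliders h hc h1,
      arc_of_mem_colliders h hc (p.adj_getVert_succ hi).symm⟩

theorem not_transGen_of_mem_colliders (h : IsChainAlong D.skeleton σ) {v w : Fin n}
    (hv : v ∈ D.colliders) : ¬ Relation.TransGen D.Arc v w := by
  intro ht
  obtain ⟨x, hx, -⟩ := Relation.TransGen.head'_iff.1 ht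
  exact not_arc_symm hx (arc_of_mem_colliders h hv (arc_adj hx).symm)

/-- In a chain, `S` d-separates `u` and `v` exactly when, strictly between them, it differs from
the set of colliders: there is only one path, and colliders of a chain have no descendants. -/
theorem dSep_iff (h : IsChainAlong D.skeleton σ) {u v : Fin n} (S : Set (Fin n)) :
    D.DSep u v S ↔
      ∃ w ∈ pathSupport σ u v, w ≠ u ∧ w ≠ v ∧ ¬ (w ∈ S ↔ w ∈ D.colliders) := by
  constructor
  · intro hs
    obtain ⟨p, hp⟩ := h.preconnected.exists_isPath u v
    obtain ⟨i, hi0, hi, hi'⟩ := hs p hp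
    obtain ⟨h1, h2, h3⟩ := (exists_getVert_iff h p hp _).1 ⟨i, hi0, hi, rfl⟩
    rw [colliderOn_iff h p hp hi0 hi] at hi'
    exact ⟨_, h1, h2, h3, by tauto⟩
  · rintro ⟨w, h1, h2, h3, h4⟩ p hp
    obtain ⟨i, hi0, hi, rfl⟩ := (exists_getVert_iff h p hp w).2 ⟨h1, h2, h3⟩
    refine ⟨i, hi0, hi, ?_⟩
    rw [colliderOn_iff h p hp hi0 hi]
    by_cases hc : p.getVert i ∈ D.colliders
    · exact Or.inr ⟨hc, by tauto, fun w hw => (not_transGen_of_mem_colliders h hc hw).elim⟩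
    · exact Or.inl ⟨hc, by tauto⟩

end BayesNet

/-! ### Sets with a prescribed trace -/

/-- The sets that coincide with `K` on `J`. -/
noncomputable def agreeOn {α : Type*} [Fintype α] (J : Finset α) (K : Set α) :
    Finset (Finset α) := by
  classical exact Finset.univ.filter fun S => ∀ w ∈ J, w ∈ S ↔ w ∈ K

section agreeOn

variable {α : Type*} [Fintype α]

theorem mem_agreeOn {J : Finset α} {K : Set α} {S : Finset α} :
    S ∈ agreeOn J K ↔ ∀ w ∈ J, w ∈ S ↔ w ∈ K := by
  simp [agreeOn]

/-- The sets that coincide with `K` on `J` form an interval of the Boolean lattice. -/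
theorem card_agreeOn (J : Finset α) (K : Set α) :
    (agreeOn J K).card = 2 ^ (Fintype.card α - J.card) := by
  classical
  have h : agreeOn J K = Finset.Icc (J.filter (· ∈ K)) (J.filter (· ∈ K) ∪ Jᶜ) := by
    ext S
    simp only [mem_agreeOn, Finset.mem_Icc, Finset.subset_iff,
      Finset.mem_filter, Finset.mem_union, Finset.mem_compl]
    constructor
    · intro hS
      exact ⟨fun x hx => (hS x hx.1).2 hx.2, fun x hx => by
        by_cases hJ : x ∈ J
        · exact Or.inl ⟨hJ, (hS x hJ).1 hx⟩
        · exact Or.inr hJ⟩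
    · rintro ⟨h1, h2⟩ w hw
      exact ⟨fun hwS => by simpa [hw] using h2 hwS, fun hwK => h1 ⟨hw, hwK⟩⟩
  have hdisj : Disjoint (J.filter (· ∈ K)) Jᶜ :=
    Finset.disjoint_left.2 fun x hx hx' =>
      Finset.mem_compl.1 hx' (Finset.mem_filter.1 hx).1
  rw [h, Finset.card_Icc_finset Finset.subset_union_left, Finset.card_union_of_disjoint hdisj,
    Finset.card_compl, Nat.add_sub_cancel_left]

theorem card_agreeOn_inter_le [DecidableEq α] (J J' : Finset α) (K K' : Set α) :
    (agreeOn J K ∩ agreeOn J' K').card ≤ 2 ^ (Fintype.card α - (J ∪ J').card) := by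
  rcases (agreeOn J K ∩ agreeOn J' K').eq_empty_or_nonempty with h | ⟨S₀, h₀⟩
  · simp [h]
  · rw [← card_agreeOn (J ∪ J') (S₀ : Set α)]
    refine Finset.card_le_card fun S hS => ?_
    simp only [Finset.mem_inter, mem_agreeOn, Finset.mem_union, Finset.mem_coe] at *
    rintro w (hw | hw)
    · rw [hS.1 w hw, h₀.1 w hw]
    · rw [hS.2 w hw, h₀.2 w hw]

end agreeOn

/-! ### Sums over unordered pairs -/

section pairSum

variable {n : ℕ}

/-- The sum of `f` over all pairs `i < j`. -/
def pairSum (f : Fin n → Fin n → ℕ) : ℕ :=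
  ∑ p : Fin n × Fin n with p.1 < p.2, f p.1 p.2

theorem pairSum_eq_sum_sum (f : Fin n → Fin n → ℕ) :
    pairSum f = ∑ j, ∑ i, if i < j then f i j else 0 := by
  rw [pairSum, Finset.sum_filter, Fintype.sum_prod_type, Finset.sum_comm]

theorem two_mul_pairSum (f : Fin n → Fin n → ℕ) (hf : ∀ u v, f u v = f v u) :
    2 * pairSum f = ∑ i, ∑ j, if i ≠ j then f i j else 0 := by
  have h : ∀ i j : Fin n, (if i ≠ j then f i j else 0) =
      (if j < i then f j i else 0) + (if i < j then f i j else 0) := by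
    intro i j
    rcases lt_trichotomy i j with h | rfl | h
    · simp [h, h.ne, h.not_gt]
    · simp
    · simp [h, h.ne', h.not_gt, hf i j]
  simp_rw [h, Finset.sum_add_distrib]
  rw [Finset.sum_comm (f := fun i j => if i < j then f i j else 0), ← pairSum_eq_sum_sum]
  ring

/-- A sum over unordered pairs may be taken along any ordering. -/
theorem pairSum_comp_perm (f : Fin n → Fin n → ℕ) (hf : ∀ u v, f u v = f v u)
    (σ : Equiv.Perm (Fin n)) : pairSum (fun i j => f (σ i) (σ j)) = pairSum f := by
  have h1 := two_mul_pairSum f hf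
  have h2 := two_mul_pairSum (fun i j => f (σ i) (σ j)) (fun u v => hf _ _)
  have h3 : (∑ i, ∑ j, if i ≠ j then f (σ i) (σ j) else 0) =
      ∑ i, ∑ j, if i ≠ j then f i j else 0 := by
    rw [← Equiv.sum_comp σ (fun i => ∑ j, if i ≠ j then f i j else 0)]
    refine Finset.sum_congr rfl fun i _ => ?_
    rw [← Equiv.sum_comp σ (fun j => if σ i ≠ j then f (σ i) j else 0)]
    simp
  omega

theorem sum_le_pairSum (f : Fin n → Fin n → ℕ) (s : Finset (Fin n × Fin n))
    (hs : ∀ p ∈ s, p.1 < p.2) : ∑ p ∈ s, f p.1 p.2 ≤ pairSum f :=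
  Finset.sum_le_sum_of_subset fun p hp => by simpa using hs p hp

theorem sum_two_pow_tail (hn : 2 ≤ n) :
    (∑ j : Fin n, if 2 ≤ (j : ℕ) then 2 ^ (n - j) else 0) = 2 ^ (n - 1) - 2 := by
  have key : ∀ m ≤ n - 2, (∑ j ∈ Finset.range (2 + m), if 2 ≤ j then 2 ^ (n - j) else 0) +
      2 ^ (n - 1 - m) = 2 ^ (n - 1) := by
    intro m
    induction m with
    | zero => intro _; simp [Finset.sum_range_succ]
    | succ m ih =>
      intro hm
      have h1 := ih (by omega)
      rw [← add_assoc, Finset.sum_range_succ, if_pos (by omega)]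
      have h2 : 2 ^ (n - 1 - m) = 2 ^ (n - (2 + m)) + 2 ^ (n - 1 - (m + 1)) := by
        rw [show n - 1 - m = n - 1 - (m + 1) + 1 by omega,
          show n - (2 + m) = n - 1 - (m + 1) by omega, pow_succ]
        ring
      omega
  rw [Fin.sum_univ_eq_sum_range (fun j => if 2 ≤ j then 2 ^ (n - j) else 0)]
  have := key (n - 2) le_rfl
  rw [show 2 + (n - 2) = n by omega, show n - 1 - (n - 2) = 1 by omega] at this
  omega

theorem sum_zero_one_le (hn : 2 ≤ n) (f : Fin n → ℕ) :
    f ⟨0, by omega⟩ + f ⟨1, by omega⟩ ≤ ∑ i, f i := by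
  rw [← Finset.sum_pair (f := f) (by simp [Fin.ext_iff])]
  exact Finset.sum_le_sum_of_subset (Finset.subset_univ _)

theorem two_pow_le_pairSum_of_tail (hn : 2 ≤ n) (f : Fin n → Fin n → ℕ)
    (hf : ∀ j : Fin n, 2 ≤ (j : ℕ) →
      2 ^ (n - j) ≤ f ⟨0, by omega⟩ j + f ⟨1, by omega⟩ j) :
    2 ^ (n - 1) - 2 ≤ pairSum f := by
  rw [← sum_two_pow_tail hn, pairSum_eq_sum_sum]
  refine Finset.sum_le_sum fun j _ => ?_
  split_ifs with hj
  · refine (hf j hj).trans (le_trans (le_of_eq ?_) (sum_zero_one_le hn _))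
    rw [if_pos (by rw [Fin.lt_def]; simp only; omega),
      if_pos (by rw [Fin.lt_def]; simp only; omega)]
  · exact Nat.zero_le _

theorem pairSum_eq_of_tail (hn : 2 ≤ n) (f : Fin n → Fin n → ℕ)
    (h01 : ∀ j : Fin n, 2 ≤ (j : ℕ) → f ⟨0, by omega⟩ j + f ⟨1, by omega⟩ j = 2 ^ (n - j))
    (h0 : ∀ i j : Fin n, i < j → (2 ≤ (i : ℕ) ∨ (j : ℕ) < 2) → f i j = 0) :
    pairSum f = 2 ^ (n - 1) - 2 := by
  rw [← sum_two_pow_tail hn, pairSum_eq_sum_sum]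
  refine Finset.sum_congr rfl fun j _ => ?_
  split_ifs with hj
  · rw [← h01 j hj, ← Finset.sum_subset (Finset.subset_univ
      {(⟨0, by omega⟩ : Fin n), (⟨1, by omega⟩ : Fin n)}),
      Finset.sum_pair (by simp [Fin.ext_iff])]
    · rw [if_pos (by rw [Fin.lt_def]; simp only; omega),
        if_pos (by rw [Fin.lt_def]; simp only; omega)]
    · intro i _ hi
      simp only [Finset.mem_insert, Finset.mem_singleton, Fin.ext_iff, not_or] at hi
      split_ifs with hij
      · exact h0 i j hij (Or.inl (by omega))
      · rfl
  · refine Finset.sum_eq_zero fun i _ => ?_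
    split_ifs with hij
    · exact h0 i j hij (Or.inr (by omega))
    · rfl

theorem add_le_pairSum (f : Fin n → Fin n → ℕ) {i j k l : Fin n} (hij : i < j) (hkl : k < l)
    (hne : (i, j) ≠ (k, l)) : f i j + f k l ≤ pairSum f := by
  have := sum_le_pairSum f {(i, j), (k, l)} (by simp [hij, hkl])
  rwa [Finset.sum_pair hne] at this

theorem add_add_le_pairSum (f : Fin n → Fin n → ℕ) {i j k l r s : Fin n} (hij : i < j)
    (hkl : k < l) (hrs : r < s) (h1 : (i, j) ≠ (k, l)) (h2 : (i, j) ≠ (r, s))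
    (h3 : (k, l) ≠ (r, s)) : f i j + (f k l + f r s) ≤ pairSum f := by
  have := sum_le_pairSum f {(i, j), (k, l), (r, s)} (by simp [hij, hkl, hrs])
  rwa [Finset.sum_insert (by simp only [Finset.mem_insert, Finset.mem_singleton]; tauto),
    Finset.sum_pair h3] at this

end pairSum

/-! ### The distance as a sum over pairs of vertices -/

namespace BayesNet

variable {n : ℕ}

/-- The sets `S` avoiding `u` and `v` that do not d-separate `u` and `v`. -/
noncomputable def connecting (D : BayesNet (Fin n)) (u v : Fin n) : Finset (Finset (Fin n)) := by
  classical exact Finset.univ.filter fun S => u ∉ S ∧ v ∉ S ∧ ¬ D.DSep u v (S : Set (Fin n))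

theorem mem_connecting {D : BayesNet (Fin n)} {u v : Fin n} {S : Finset (Fin n)} :
    S ∈ D.connecting u v ↔ u ∉ S ∧ v ∉ S ∧ ¬ D.DSep u v (S : Set (Fin n)) := by
  simp [connecting]

/-- The number of sets on whose separation of `u` and `v` the two networks disagree. -/
noncomputable def pairDist (D D' : BayesNet (Fin n)) (u v : Fin n) : ℕ :=
  (symmDiff (D.connecting u v) (D'.connecting u v)).card

theorem dist_eq_pairSum (D D' : BayesNet (Fin n)) : D.dist D' = pairSum (D.pairDist D') := by
  classical
  rw [dist, pairSum]
  simp_rw [pairDist]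
  rw [← Finset.card_sigma, ← Set.ncard_coe_finset]
  refine Set.ncard_congr (fun t _ => ⟨(t.1, t.2.1), t.2.2⟩) ?_ ?_ ?_
  · rintro ⟨u, v, S⟩ ⟨h1, h2, h3, h4⟩
    simp only [Finset.coe_sigma, Set.mem_sigma_iff, Finset.mem_coe, Finset.mem_filter,
      Finset.mem_univ, true_and, Finset.mem_symmDiff, mem_connecting]
    simp only at h1 h2 h3 h4
    tauto
  · rintro ⟨u, v, S⟩ ⟨u', v', S'⟩ _ _ h
    simp only [Sigma.mk.injEq, Prod.mk.injEq, heq_eq_eq] at h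
    obtain ⟨⟨rfl, rfl⟩, rfl⟩ := h
    rfl
  · rintro ⟨⟨u, v⟩, S⟩ h
    simp only [Finset.coe_sigma, Set.mem_sigma_iff, Finset.mem_coe, Finset.mem_filter,
      Finset.mem_univ, true_and, Finset.mem_symmDiff, mem_connecting] at h
    refine ⟨(u, v, S), ?_, rfl⟩
    simp only [Set.mem_ofPred_eq]
    tauto

variable {D D' : BayesNet (Fin n)} {σ τ : Equiv.Perm (Fin n)} {u v : Fin n}

theorem connecting_eq_agreeOn (h : IsChainAlong D.skeleton σ) (u v : Fin n) :
    D.connecting u v = agreeOn (pathSupport σ u v) (D.colliders \ {u, v}) := by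
  ext S
  rw [mem_connecting, mem_agreeOn, dSep_iff h]
  simp only [Set.mem_sdiff, Set.mem_insert_iff, Set.mem_singleton_iff, Finset.mem_coe]
  constructor
  · rintro ⟨hu, hv, hS⟩ w hw
    by_cases h1 : w = u
    · subst h1; tauto
    by_cases h2 : w = v
    · subst h2; tauto
    have : w ∈ S ↔ w ∈ D.colliders := by
      by_contra h3
      exact hS ⟨w, hw, h1, h2, h3⟩
    tauto
  · intro hS
    refine ⟨?_, ?_, ?_⟩
    · have := hS u (left_mem_pathSupport u v); tauto
    · have := hS v (right_mem_pathSupport u v); tauto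
    · rintro ⟨w, hw, h1, h2, h3⟩
      have := hS w hw
      tauto

theorem connecting_comm (h : IsChainAlong D.skeleton σ) (u v : Fin n) :
    D.connecting u v = D.connecting v u := by
  rw [connecting_eq_agreeOn h, connecting_eq_agreeOn h, pathSupport_comm, Set.pair_comm]

theorem card_connecting (h : IsChainAlong D.skeleton σ) (u v : Fin n) :
    (D.connecting u v).card = 2 ^ (n - (pathSupport σ u v).card) := by
  rw [connecting_eq_agreeOn h, card_agreeOn, Fintype.card_fin]

theorem pairDist_comm (h : IsChainAlong D.skeleton σ) (h' : IsChainAlong D'.skeleton τ)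
    (u v : Fin n) : D.pairDist D' u v = D.pairDist D' v u := by
  rw [pairDist, pairDist, connecting_comm h, connecting_comm h']

theorem pairDist_symm (D D' : BayesNet (Fin n)) (u v : Fin n) :
    D.pairDist D' u v = D'.pairDist D u v := by
  rw [pairDist, pairDist, symmDiff_comm]

theorem pairDist_add_inter (D D' : BayesNet (Fin n)) (u v : Fin n) :
    D.pairDist D' u v + 2 * (D.connecting u v ∩ D'.connecting u v).card =
      (D.connecting u v).card + (D'.connecting u v).card := by
  rw [pairDist, symmDiff, Finset.sup_eq_union, Finset.card_union_of_disjoint disjoint_sdiff_sdiff]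
  have h1 := Finset.card_sdiff_add_card_inter (D.connecting u v) (D'.connecting u v)
  have h2 := Finset.card_sdiff_add_card_inter (D'.connecting u v) (D.connecting u v)
  rw [Finset.inter_comm] at h2
  omega

theorem dist_eq_pairSum_perm (h : IsChainAlong D.skeleton σ) (h' : IsChainAlong D'.skeleton τ)
    (π : Equiv.Perm (Fin n)) :
    D.dist D' = pairSum (fun i j => D.pairDist D' (π i) (π j)) := by
  rw [dist_eq_pairSum, pairSum_comp_perm _ (pairDist_comm h h')]

/-- The symmetric difference of two subcubes is at least the difference of their sizes. -/
theorem two_pow_le_pairDist_add (h : IsChainAlong D.skeleton σ)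
    (h' : IsChainAlong D'.skeleton τ) (u v : Fin n) :
    2 ^ (n - (pathSupport σ u v).card) ≤
      D.pairDist D' u v + 2 ^ (n - (pathSupport τ u v).card) := by
  have h1 := pairDist_add_inter D D' u v
  have h2 := Finset.card_le_card
    (Finset.inter_subset_right (s₁ := D.connecting u v) (s₂ := D'.connecting u v))
  rw [card_connecting h, card_connecting h'] at h1
  rw [card_connecting h'] at h2
  omega

/-- The intersection of the two subcubes is contained in a subcube that fixes the union of both
paths. -/
theorem two_pow_add_le_pairDist_add (h : IsChainAlong D.skeleton σ)
    (h' : IsChainAlong D'.skeleton τ) (u v : Fin n) :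
    2 ^ (n - (pathSupport σ u v).card) + 2 ^ (n - (pathSupport τ u v).card) ≤
      D.pairDist D' u v + 2 * 2 ^ (n - (pathSupport σ u v ∪ pathSupport τ u v).card) := by
  have h1 := pairDist_add_inter D D' u v
  have h2 := card_agreeOn_inter_le (pathSupport σ u v) (pathSupport τ u v)
    (D.colliders \ {u, v}) (D'.colliders \ {u, v})
  rw [← connecting_eq_agreeOn h, ← connecting_eq_agreeOn h', Fintype.card_fin] at h2
  rw [card_connecting h, card_connecting h'] at h1
  omega

theorem dist_eq_zero_of_markovEquiv (h : D'.MarkovEquiv D) : D.dist D' = 0 := by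
  rw [dist, Set.ncard_eq_zero, Set.eq_empty_iff_forall_notMem]
  rintro ⟨u, v, S⟩ ⟨h1, h2, h3, h4⟩
  exact h4 (h u v S h1.ne h2 h3).symm


/-! ### Equal skeletons -/

theorem pos_of_mem_colliders (h : IsChainAlong D.skeleton σ) {x : Fin n}
    (hx : x ∈ D.colliders) : 0 < (σ.symm x : ℕ) ∧ (σ.symm x : ℕ) + 1 < n := by
  obtain ⟨u, w, huw, hu, hw⟩ := hx
  have h1 := (h.adj_iff _ _).1 (arc_adj hu)
  have h2 := (h.adj_iff _ _).1 (arc_adj hw)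
  have h4 : (σ.symm u : ℕ) ≠ σ.symm w := fun h' => huw (σ.symm.injective (Fin.ext h'))
  omega

theorem pairDist_eq_of_collider_diff (h : IsChainAlong D.skeleton σ)
    (h' : IsChainAlong D'.skeleton σ) {x u v : Fin n}
    (hx : ¬ (x ∈ D.colliders ↔ x ∈ D'.colliders)) (hu : (σ.symm u : ℕ) < σ.symm x)
    (hv : (σ.symm x : ℕ) < σ.symm v) :
    D.pairDist D' u v = 2 * 2 ^ (n - (σ.symm v - σ.symm u + 1)) := by
  have h1 := pairDist_add_inter D D' u v
  have h2 : D.connecting u v ∩ D'.connecting u v = ∅ := by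
    rw [connecting_eq_agreeOn h, connecting_eq_agreeOn h', Finset.eq_empty_iff_forall_notMem]
    intro S hS
    rw [Finset.mem_inter, mem_agreeOn, mem_agreeOn] at hS
    have hmem : x ∈ pathSupport σ u v := by rw [mem_pathSupport]; omega
    have h3 := hS.1 x hmem
    have h4 := hS.2 x hmem
    have h5 : x ≠ u := by rintro rfl; omega
    have h6 : x ≠ v := by rintro rfl; omega
    simp only [Set.mem_sdiff, Set.mem_insert_iff, Set.mem_singleton_iff] at h3 h4
    tauto
  rw [h2, card_connecting h, card_connecting h', card_pathSupport,
    show ((σ.symm v : ℤ) - σ.symm u).natAbs = σ.symm v - σ.symm u by omega] at h1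
  simp only [Finset.card_empty] at h1
  omega

/-- The pairs of the first vertex with the vertices from the third on contribute enough. -/
theorem two_pow_le_dist_of_collider_diff_at_one (hn : 2 < n) (h : IsChainAlong D.skeleton σ)
    (h' : IsChainAlong D'.skeleton σ) {x : Fin n}
    (hx : ¬ (x ∈ D.colliders ↔ x ∈ D'.colliders)) (hx1 : (σ.symm x : ℕ) = 1) :
    2 ^ (n - 1) - 2 ≤ D.dist D' := by
  rw [dist_eq_pairSum_perm h h' σ]
  refine two_pow_le_pairSum_of_tail (by omega) _ fun j hj => le_trans ?_ (Nat.le_add_right _ _)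
  rw [pairDist_eq_of_collider_diff h h' hx (by simp; omega) (by simp; omega)]
  simp only [Equiv.symm_apply_apply]
  rw [← pow_succ']
  exact Nat.pow_le_pow_right (by norm_num) (by omega)

theorem two_pow_le_dist_of_skeleton_eq (hn : 2 < n) (h : IsChainAlong D.skeleton σ)
    (h' : IsChainAlong D'.skeleton σ) (hne : ¬ D'.MarkovEquiv D) :
    2 ^ (n - 1) - 2 ≤ D.dist D' := by
  obtain ⟨x, hx⟩ : ∃ x, ¬ (x ∈ D.colliders ↔ x ∈ D'.colliders) := by
    by_contra hcon
    push Not at hcon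
    refine hne fun u v S _ _ _ => ?_
    rw [dSep_iff h, dSep_iff h']
    simp_rw [hcon]
  have hpos : 0 < (σ.symm x : ℕ) ∧ (σ.symm x : ℕ) + 1 < n := by
    by_cases hc : x ∈ D.colliders
    · exact pos_of_mem_colliders h hc
    · exact pos_of_mem_colliders h' (by tauto)
  by_cases h1 : (σ.symm x : ℕ) = 1
  · exact two_pow_le_dist_of_collider_diff_at_one hn h h' hx h1
  by_cases h2 : (σ.symm x : ℕ) + 2 = n
  · exact two_pow_le_dist_of_collider_diff_at_one hn h.rev h'.rev hx
      (by rw [val_symm_rev_trans]; omega)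
  generalize hk : (σ.symm x : ℕ) = k at *
  -- The pairs of positions `(k - 1, k + 1)`, `(k - 2, k + 1)`, `(k - 1, k + 2)` suffice.
  have h3 := add_add_le_pairSum (fun i j => D.pairDist D' (σ i) (σ j))
    (i := ⟨k - 1, by omega⟩) (j := ⟨k + 1, by omega⟩) (k := ⟨k - 2, by omega⟩)
    (l := ⟨k + 1, by omega⟩) (r := ⟨k - 1, by omega⟩) (s := ⟨k + 2, by omega⟩)
    (by simp [Fin.lt_def]) (by simp [Fin.lt_def]) (by simp [Fin.lt_def]; omega)
    (by simp [Fin.ext_iff]; omega) (by simp [Fin.ext_iff]) (by simp [Fin.ext_iff])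
  rw [dist_eq_pairSum_perm h h' σ]
  refine le_trans ?_ h3
  rw [pairDist_eq_of_collider_diff h h' hx (by simp; omega) (by simp; omega),
    pairDist_eq_of_collider_diff h h' hx (by simp; omega) (by simp; omega),
    pairDist_eq_of_collider_diff h h' hx (by simp; omega) (by simp; omega)]
  simp only [Equiv.symm_apply_apply]
  rw [show n - (k + 1 - (k - 1) + 1) = n - 4 + 1 by omega,
    show n - (k + 1 - (k - 2) + 1) = n - 4 by omega,
    show n - (k + 2 - (k - 1) + 1) = n - 4 by omega, show n - 1 = n - 4 + 3 by omega,
    pow_add, pow_succ]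
  omega

/-! ### Skeletons with a single different edge -/

theorem two_pow_le_pairDist_add_of_pos (h : IsChainAlong D.skeleton σ)
    (h' : IsChainAlong D'.skeleton τ) {u v : Fin n} {s t : ℕ}
    (hs : ((σ.symm v : ℤ) - σ.symm u).natAbs + 1 = s)
    (ht : ((τ.symm v : ℤ) - τ.symm u).natAbs + 1 = t) :
    2 ^ (n - s) ≤ D.pairDist D' u v + 2 ^ (n - t) ∧
      2 ^ (n - t) ≤ D.pairDist D' u v + 2 ^ (n - s) := by
  rw [← hs, ← ht, ← card_pathSupport, ← card_pathSupport]
  refine ⟨two_pow_le_pairDist_add h h' u v, ?_⟩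
  rw [pairDist_symm]
  exact two_pow_le_pairDist_add h' h u v

/-- The case in which the chain of `D'` arises from that of `D` by reversing the first `k`
vertices. -/
theorem two_pow_le_dist_of_reversed_prefix (hn : 2 < n) (h : IsChainAlong D.skeleton σ)
    (h' : IsChainAlong D'.skeleton τ) {k : ℕ} (hk2 : 2 ≤ k) (hkn : k < n)
    (hlow : ∀ i : Fin n, (i : ℕ) < k → (τ.symm (σ i) : ℕ) = k - 1 - i)
    (hhigh : ∀ i : Fin n, k ≤ (i : ℕ) → (τ.symm (σ i) : ℕ) = i) :
    2 ^ (n - 1) - 2 ≤ D.dist D' := by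
  rw [dist_eq_pairSum_perm h h' σ]
  rcases (by omega : k = 2 ∨ 3 ≤ k) with rfl | hk3
  · refine two_pow_le_pairSum_of_tail (by omega) _ fun j hj => ?_
    have h0 := hlow ⟨0, by omega⟩ (by simp)
    have h1 := hlow ⟨1, by omega⟩ (by simp)
    have h2 := hhigh j hj
    simp only at h0 h1
    have hjn := j.isLt
    have e1 := (two_pow_le_pairDist_add_of_pos h h' (u := σ ⟨0, by omega⟩) (v := σ j)
      (s := j + 1) (t := j) (by simp) (by rw [h0, h2]; omega)).2
    have e2 := (two_pow_le_pairDist_add_of_pos h h' (u := σ ⟨1, by omega⟩) (v := σ j)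
      (s := j) (t := j + 1) (by simp; omega) (by rw [h1, h2]; omega)).1
    have e3 : 2 ^ (n - j) = 2 * 2 ^ (n - (j + 1)) := by
      rw [← pow_succ']; congr 1; omega
    omega
  · -- The pairs of positions `(k - 1, k)`, `(0, k)`, `(1, k)` suffice.
    have h3 := add_add_le_pairSum (fun i j => D.pairDist D' (σ i) (σ j))
      (i := ⟨k - 1, by omega⟩) (j := ⟨k, by omega⟩) (k := ⟨0, by omega⟩)
      (l := ⟨k, by omega⟩) (r := ⟨1, by omega⟩) (s := ⟨k, by omega⟩)
      (by simp [Fin.lt_def]; omega) (by simp [Fin.lt_def]; omega) (by simp [Fin.lt_def]; omega)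
      (by simp [Fin.ext_iff]; omega) (by simp [Fin.ext_iff]; omega) (by simp [Fin.ext_iff])
    refine le_trans ?_ h3
    have p0 := hlow ⟨0, by omega⟩ (by simp; omega)
    have p1 := hlow ⟨1, by omega⟩ (by simp; omega)
    have pk1 := hlow ⟨k - 1, by omega⟩ (by simp; omega)
    have pk := hhigh ⟨k, by omega⟩ (by simp)
    simp only at p0 p1 pk1 pk
    have e1 := (two_pow_le_pairDist_add_of_pos h h' (u := σ ⟨k - 1, by omega⟩)
      (v := σ ⟨k, by omega⟩) (s := 2) (t := k + 1) (by simp; omega) (by rw [pk1, pk]; omega)).1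
    have e2 := (two_pow_le_pairDist_add_of_pos h h' (u := σ ⟨0, by omega⟩)
      (v := σ ⟨k, by omega⟩) (s := k + 1) (t := 2) (by simp) (by rw [p0, pk]; omega)).2
    have e3 := two_pow_add_le_pairDist_add h h' (σ ⟨1, by omega⟩) (σ ⟨k, by omega⟩)
    have c1 : (pathSupport σ (σ ⟨1, by omega⟩) (σ ⟨k, by omega⟩)).card = k := by
      rw [card_pathSupport]; simp; omega
    have c2 : (pathSupport τ (σ ⟨1, by omega⟩) (σ ⟨k, by omega⟩)).card = 3 := by
      rw [card_pathSupport, p1, pk]; omega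
    -- The vertex at position `0` lies on the second path only.
    have c3 : k + 1 ≤ (pathSupport σ (σ ⟨1, by omega⟩) (σ ⟨k, by omega⟩) ∪
        pathSupport τ (σ ⟨1, by omega⟩) (σ ⟨k, by omega⟩)).card := by
      rw [Nat.succ_le_iff]
      refine c1.symm.trans_lt <| Finset.card_lt_card (Finset.ssubset_iff_subset_ne.2
        ⟨Finset.subset_union_left, fun heq => ?_⟩)
      have hm : σ ⟨0, by omega⟩ ∈ pathSupport σ (σ ⟨1, by omega⟩) (σ ⟨k, by omega⟩) := by
        rw [heq, Finset.mem_union]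
        right
        rw [mem_pathSupport, p0, p1, pk]
        omega
      rw [mem_pathSupport] at hm
      simp at hm
      omega
    have e4 : 2 ^ (n - (pathSupport σ (σ ⟨1, by omega⟩) (σ ⟨k, by omega⟩) ∪
        pathSupport τ (σ ⟨1, by omega⟩) (σ ⟨k, by omega⟩)).card) ≤ 2 ^ (n - (k + 1)) :=
      Nat.pow_le_pow_right (by norm_num) (by omega)
    rw [c1, c2] at e3
    have e5 : 2 ^ (n - k) = 2 * 2 ^ (n - (k + 1)) := by
      rw [← pow_succ']; congr 1; omega
    have e6 : 2 ^ (n - k) ≤ 2 ^ (n - 3) := Nat.pow_le_pow_right (by norm_num) (by omega)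
    have e7 : 2 ^ (n - 2) = 2 * 2 ^ (n - 3) := by
      rw [← pow_succ']; congr 1; omega
    have e8 : 2 ^ (n - 1) = 2 * 2 ^ (n - 2) := by
      rw [← pow_succ']; congr 1; omega
    omega

/-- The case in which the chain of `D'` arises from that of `D` by reversing the first `k` vertices
as well as the others, hence is a cyclic shift read backwards: the removed edge joins the ends of
the chain of `D'`, the new edge those of the chain of `D`. -/
theorem two_pow_le_dist_of_rotation (hn : 2 < n) (h : IsChainAlong D.skeleton σ)
    (h' : IsChainAlong D'.skeleton τ) {k : ℕ} (hk1 : 1 ≤ k) (hkn : k < n)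
    (hlow : ∀ i : Fin n, (i : ℕ) < k → (τ.symm (σ i) : ℕ) = k - 1 - i)
    (hhigh : ∀ i : Fin n, k ≤ (i : ℕ) → (τ.symm (σ i) : ℕ) = n - 1 + k - i) :
    2 ^ (n - 1) - 2 ≤ D.dist D' := by
  rw [dist_eq_pairSum_perm h h' σ]
  have h3 := add_le_pairSum (fun i j => D.pairDist D' (σ i) (σ j))
    (i := ⟨k - 1, by omega⟩) (j := ⟨k, by omega⟩) (k := ⟨0, by omega⟩)
    (l := ⟨n - 1, by omega⟩) (by simp [Fin.lt_def]; omega) (by simp [Fin.lt_def]; omega)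
    (by simp [Fin.ext_iff]; omega)
  refine le_trans ?_ h3
  have p0 := hlow ⟨0, by omega⟩ (by simp; omega)
  have pk1 := hlow ⟨k - 1, by omega⟩ (by simp; omega)
  have pk := hhigh ⟨k, by omega⟩ (by simp)
  have pn := hhigh ⟨n - 1, by omega⟩ (by simp; omega)
  simp only at p0 pk1 pk pn
  have e1 := (two_pow_le_pairDist_add_of_pos h h' (u := σ ⟨k - 1, by omega⟩)
    (v := σ ⟨k, by omega⟩) (s := 2) (t := n) (by simp; omega) (by rw [pk1, pk]; omega)).1
  have e2 := (two_pow_le_pairDist_add_of_pos h h' (u := σ ⟨0, by omega⟩)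
    (v := σ ⟨n - 1, by omega⟩) (s := n) (t := 2) (by simp; omega) (by rw [p0, pn]; omega)).2
  have e8 : 2 ^ (n - 1) = 2 * 2 ^ (n - 2) := by
    rw [← pow_succ']; congr 1; omega
  rw [Nat.sub_self, pow_zero] at e1 e2
  omega


/-- A bijection of `{0, …, n - 1}` that is affine of slope `-1` on `{0, …, k - 1}` and of slope
`1` or `-1` on the rest maps these two blocks onto an initial and a final segment. -/
theorem blocks_of_slopes {k : ℕ} (hkn : k < n) (hk1 : 1 ≤ k) (b : ℕ → ℤ)
    (hb : ∀ t < n, 0 ≤ b t ∧ b t < n) (hinj : ∀ s t, s < n → t < n → b s = b t → s = t)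
    (h1 : ∀ t < k, b t = b 0 - t)
    (h2 : (∀ t < n - k, b (k + t) = b k + t) ∨ (∀ t < n - k, b (k + t) = b k - t)) :
    ((∀ t < k, b t = k - 1 - t) ∧ (∀ t < n - k, b (k + t) = k + t)) ∨
    ((∀ t < k, b t = n - 1 - t) ∧ (∀ t < n - k, b (k + t) = t)) ∨
    ((∀ t < k, b t = k - 1 - t) ∧ (∀ t < n - k, b (k + t) = n - 1 - t)) ∨
    (∀ t < n, b t = n - 1 - t) := by
  have hdis : ∀ s t : ℕ, s < k → t < n - k → b s ≠ b (k + t) := fun s t hs ht heq => by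
    have := hinj s (k + t) (by omega) (by omega) heq
    omega
  have b1 := hb 0 (by omega)
  have b2 := hb (k - 1) (by omega)
  have b3 := hb k (by omega)
  have b4 := hb (n - 1) (by omega)
  have e1 := h1 (k - 1) (by omega)
  rcases h2 with h2 | h2
  · have e2 := h2 (n - 1 - k) (by omega)
    rw [show k + (n - 1 - k) = n - 1 by omega] at e2
    have hsep : b 0 < b k ∨ b (n - 1) < b (k - 1) := by
      by_contra hcon
      push Not at hcon
      rcases le_total (b (k - 1)) (b k) with hle | hle
      · refine hdis (b 0 - b k).toNat 0 (by omega) (by omega) ?_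
        rw [h1 _ (by omega), h2 _ (by omega)]
        omega
      · refine hdis (k - 1) (b (k - 1) - b k).toNat (by omega) (by omega) ?_
        rw [h1 _ (by omega), h2 _ (by omega)]
        omega
    rcases hsep with hsep | hsep
    · left
      exact ⟨fun t ht => by rw [h1 t ht]; omega, fun t ht => by rw [h2 t ht]; omega⟩
    · right; left
      exact ⟨fun t ht => by rw [h1 t ht]; omega, fun t ht => by rw [h2 t ht]; omega⟩
  · have e2 := h2 (n - 1 - k) (by omega)
    rw [show k + (n - 1 - k) = n - 1 by omega] at e2
    have hsep : b 0 < b (n - 1) ∨ b k < b (k - 1) := by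
      by_contra hcon
      push Not at hcon
      rcases le_total (b (k - 1)) (b (n - 1)) with hle | hle
      · refine hdis (b 0 - b (n - 1)).toNat (n - 1 - k) (by omega) (by omega) ?_
        rw [h1 _ (by omega), h2 _ (by omega)]
        omega
      · refine hdis (k - 1) (b k - b (k - 1)).toNat (by omega) (by omega) ?_
        rw [h1 _ (by omega), h2 _ (by omega)]
        omega
    rcases hsep with hsep | hsep
    · right; right; left
      exact ⟨fun t ht => by rw [h1 t ht]; omega, fun t ht => by rw [h2 t ht]; omega⟩
    · right; right; right
      intro t ht
      rcases Nat.lt_or_ge t k with htk | htk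
      · rw [h1 t htk]; omega
      · have := h2 (t - k) (by omega)
        rw [show k + (t - k) = t by omega] at this
        omega

/-- The position along `σ` of the vertex at position `t` along `τ`, as an integer; `0` when `t` is
out of range. -/
def relPos (σ τ : Equiv.Perm (Fin n)) (t : ℕ) : ℤ :=
  if h : t < n then (σ.symm (τ ⟨t, h⟩) : ℤ) else 0

theorem relPos_of_lt (σ τ : Equiv.Perm (Fin n)) {t : ℕ} (h : t < n) :
    relPos σ τ t = (σ.symm (τ ⟨t, h⟩) : ℤ) := dif_pos h

theorem relPos_inj {s t : ℕ} (hs : s < n) (ht : t < n) (h : relPos σ τ s = relPos σ τ t) :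
    s = t := by
  rw [relPos_of_lt σ τ hs, relPos_of_lt σ τ ht] at h
  have := τ.injective (σ.symm.injective (Fin.ext (by exact_mod_cast h)))
  exact congrArg Fin.val this

/-- Inverting a description of `relPos`. -/
theorem symm_eq_of_relPos {i : Fin n} {t : ℕ} (ht : t < n) (h : relPos σ τ t = i) :
    (τ.symm (σ i) : ℕ) = t := by
  rw [relPos_of_lt σ τ ht] at h
  have h1 : σ.symm (τ ⟨t, ht⟩) = i := Fin.ext (by exact_mod_cast h)
  rw [← h1]
  simp

theorem relPos_rev_left (σ τ : Equiv.Perm (Fin n)) {t : ℕ} (h : t < n) :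
    relPos (Fin.revPerm.trans σ) τ t = n - 1 - relPos σ τ t := by
  rw [relPos_of_lt _ _ h, relPos_of_lt _ _ h, val_symm_rev_trans]
  omega

theorem relPos_rev_right (σ τ : Equiv.Perm (Fin n)) {t : ℕ} (h : t < n) :
    relPos σ (Fin.revPerm.trans τ) t = relPos σ τ (n - 1 - t) := by
  rw [relPos_of_lt _ _ h, relPos_of_lt _ _ (show n - 1 - t < n by omega)]
  simp only [Equiv.trans_apply, Fin.revPerm_apply]
  congr 4
  apply Fin.ext
  rw [Fin.val_rev]
  simp only
  omega

theorem adj_iff_relPos (h : IsChainAlong D.skeleton σ) (τ : Equiv.Perm (Fin n)) {t : ℕ}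
    (ht : t + 1 < n) : D.skeleton.Adj (τ ⟨t, by omega⟩) (τ ⟨t + 1, ht⟩) ↔
      (relPos σ τ (t + 1) = relPos σ τ t + 1 ∨ relPos σ τ (t + 1) = relPos σ τ t - 1) := by
  rw [h.adj_iff, relPos_of_lt _ _ (show t < n by omega), relPos_of_lt _ _ ht]
  omega

/-- The edge of `D'` at positions `k - 1`, `k` along `τ` is missing from `D`, the vertices before it
run backwards along `σ`, and those after it run in either direction. -/
theorem two_pow_le_dist_of_decreasing_block (hn : 2 < n) (h : IsChainAlong D.skeleton σ)
    (h' : IsChainAlong D'.skeleton τ) {k : ℕ} (hk1 : 1 ≤ k) (hkn : k < n)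
    (hjump : relPos σ τ k ≠ relPos σ τ (k - 1) + 1 ∧ relPos σ τ k ≠ relPos σ τ (k - 1) - 1)
    (h1 : ∀ t < k, relPos σ τ t = relPos σ τ 0 - t)
    (h2 : (∀ t < n - k, relPos σ τ (k + t) = relPos σ τ k + t) ∨
      (∀ t < n - k, relPos σ τ (k + t) = relPos σ τ k - t)) :
    2 ^ (n - 1) - 2 ≤ D.dist D' := by
  have hb : ∀ t < n, 0 ≤ relPos σ τ t ∧ relPos σ τ t < n := fun t ht => by
    rw [relPos_of_lt _ _ ht]; omega
  rcases blocks_of_slopes hkn hk1 (relPos σ τ) hb (fun s t hs ht => relPos_inj hs ht) h1 h2 with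
    ⟨c1, c2⟩ | ⟨c1, c2⟩ | ⟨c1, c2⟩ | c1
  · have hk2 : 2 ≤ k := by
      have := c1 (k - 1) (by omega)
      have := c2 0 (by omega)
      rw [add_zero] at this
      omega
    refine two_pow_le_dist_of_reversed_prefix hn h h' hk2 hkn (fun i hi => ?_) fun i hi => ?_
    · exact symm_eq_of_relPos (by omega) (by rw [c1 _ (by omega)]; omega)
    · have := c2 (i - k) (by omega)
      rw [show k + (i - k) = (i : ℕ) by omega] at this
      exact symm_eq_of_relPos (by omega) (by rw [this]; omega)
  · -- Read backwards, the ordering `τ` starts with a reversed block of `n - k` vertices.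
    have hk2 : 2 ≤ n - k := by
      have := c1 (k - 1) (by omega)
      have := c2 0 (by omega)
      rw [add_zero] at this
      omega
    refine two_pow_le_dist_of_reversed_prefix hn h h'.rev hk2 (by omega)
      (fun i hi => ?_) fun i hi => ?_
    · refine symm_eq_of_relPos (by omega) ?_
      rw [relPos_rev_right _ _ (by omega),
        show n - 1 - (n - k - 1 - (i : ℕ)) = k + i by omega, c2 _ (by omega)]
    · refine symm_eq_of_relPos (by omega) ?_
      rw [relPos_rev_right _ _ (by omega), c1 _ (by omega)]
      omega
  · refine two_pow_le_dist_of_rotation hn h h' hk1 hkn (fun i hi => ?_) fun i hi => ?_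
    · exact symm_eq_of_relPos (by omega) (by rw [c1 _ (by omega)]; omega)
    · have := c2 (n - 1 - i) (by omega)
      rw [show k + (n - 1 - i) = n - 1 + k - (i : ℕ) by omega] at this
      exact symm_eq_of_relPos (by omega) (by rw [this]; omega)
  · have := c1 k (by omega)
    have := c1 (k - 1) (by omega)
    omega

/-- Chains that differ in one edge only: each of the two blocks left after removing the edge is
traversed monotonically in both orderings. -/
theorem two_pow_le_dist_of_single_jump (hn : 2 < n) (h : IsChainAlong D.skeleton σ)
    (h' : IsChainAlong D'.skeleton τ) {k : ℕ} (hk1 : 1 ≤ k) (hkn : k < n)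
    (hjump : ¬ D.skeleton.Adj (τ ⟨k - 1, by omega⟩) (τ ⟨k, hkn⟩))
    (hstep : ∀ t, (ht : t + 1 < n) → t + 1 ≠ k →
      D.skeleton.Adj (τ ⟨t, by omega⟩) (τ ⟨t + 1, ht⟩)) :
    2 ^ (n - 1) - 2 ≤ D.dist D' := by
  have hjump' : relPos σ τ k ≠ relPos σ τ (k - 1) + 1 ∧
      relPos σ τ k ≠ relPos σ τ (k - 1) - 1 := by
    obtain ⟨m, rfl⟩ : ∃ m, k = m + 1 := ⟨k - 1, by omega⟩
    have := (adj_iff_relPos h τ hkn).not.1 hjump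
    rw [Nat.add_sub_cancel]
    tauto
  have s1 := eq_add_or_eq_sub_of_unit_steps (relPos σ τ) (k - 1)
    (fun t ht => (adj_iff_relPos h τ (by omega)).1 (hstep t (by omega) (by omega)))
    (fun t ht heq => by have := relPos_inj (by omega) (by omega) heq; omega)
  have s2 := eq_add_or_eq_sub_of_unit_steps (fun t => relPos σ τ (k + t)) (n - k - 1)
    (fun t ht => (adj_iff_relPos h τ (t := k + t) (by omega)).1
      (hstep (k + t) (by omega) (by omega)))
    (fun t ht heq => by have := relPos_inj (by omega) (by omega) heq; omega)
  simp only [add_zero] at s2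
  rcases s1 with s1 | s1
  · -- Reversing `σ` turns the increasing first block into a decreasing one.
    refine two_pow_le_dist_of_decreasing_block hn h.rev h' hk1 hkn ?_ (fun t ht => ?_) ?_
    · rw [relPos_rev_left _ _ (by omega), relPos_rev_left _ _ (by omega)]
      omega
    · rw [relPos_rev_left _ _ (by omega), relPos_rev_left _ _ (by omega), s1 t (by omega)]
      omega
    · refine s2.symm.imp (fun s t ht => ?_) (fun s t ht => ?_)
      all_goals
        rw [relPos_rev_left _ _ (by omega), relPos_rev_left _ _ (by omega), s t (by omega)]
        omega
  · exact two_pow_le_dist_of_decreasing_block hn h h' hk1 hkn hjump'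
      (fun t ht => s1 t (by omega))
      (s2.imp (fun s t ht => s t (by omega)) (fun s t ht => s t (by omega)))

/-! ### The lower bound -/

/-- The edges of `G` missing from `G'`, as increasing pairs. -/
noncomputable def edgeDiff (G G' : SimpleGraph (Fin n)) : Finset (Fin n × Fin n) := by
  classical exact Finset.univ.filter fun p => p.1 < p.2 ∧ G.Adj p.1 p.2 ∧ ¬ G'.Adj p.1 p.2

theorem mem_edgeDiff {G G' : SimpleGraph (Fin n)} {p : Fin n × Fin n} :
    p ∈ edgeDiff G G' ↔ p.1 < p.2 ∧ G.Adj p.1 p.2 ∧ ¬ G'.Adj p.1 p.2 := by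
  simp [edgeDiff]

/-- All chains have equally many edges. -/
theorem card_edgeDiff_comm {G G' : SimpleGraph (Fin n)} (h : IsChainAlong G σ)
    (h' : IsChainAlong G' τ) : (edgeDiff G G').card = (edgeDiff G' G).card := by
  classical
  have key : ∀ {G : SimpleGraph (Fin n)} {σ : Equiv.Perm (Fin n)}, IsChainAlong G σ →
      (Finset.univ.filter fun p : Fin n × Fin n => p.1 < p.2 ∧ G.Adj p.1 p.2).card =
        pairSum fun i j : Fin n => if (i : ℕ) + 1 = j ∨ (j : ℕ) + 1 = i then 1 else 0 := by
    intro G σ h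
    rw [← Finset.filter_filter, Finset.card_filter]
    change pairSum (fun u v => if G.Adj u v then 1 else 0) = _
    rw [← pairSum_comp_perm _ (fun u v => by simp only [G.adj_comm u v]) σ]
    simp only [h _ _]
  have h1 := (key h).trans (key h').symm
  have h2 := Finset.card_sdiff_comm h1
  convert h2 using 2
  all_goals
    ext p
    simp only [mem_edgeDiff, Finset.mem_sdiff, Finset.mem_filter, Finset.mem_univ, true_and]
    tauto

theorem two_pow_le_pairDist_of_adj_diff (hn : 2 < n) (h : IsChainAlong D.skeleton σ)
    (h' : IsChainAlong D'.skeleton τ) {u v : Fin n} (huv : D.skeleton.Adj u v)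
    (huv' : ¬ D'.skeleton.Adj u v) : 2 ^ (n - 3) ≤ D.pairDist D' u v := by
  rw [h.adj_iff] at huv
  rw [h'.adj_iff] at huv'
  have hne : (τ.symm u : ℕ) ≠ τ.symm v := fun heq => by
    rw [τ.symm.injective (Fin.ext heq)] at huv
    omega
  have h1 := (two_pow_le_pairDist_add_of_pos h h' (u := u) (v := v) (s := 2) (by omega) rfl).1
  have h2 : 2 ^ (n - (((τ.symm v : ℤ) - τ.symm u).natAbs + 1)) ≤ 2 ^ (n - 3) :=
    Nat.pow_le_pow_right (by norm_num) (by omega)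
  have h3 : 2 ^ (n - 2) = 2 * 2 ^ (n - 3) := by
    rw [← pow_succ']; congr 1; omega
  omega

theorem two_pow_le_dist_of_two_le_card_edgeDiff (hn : 2 < n) (h : IsChainAlong D.skeleton σ)
    (h' : IsChainAlong D'.skeleton τ)
    (hcard : 2 ≤ (edgeDiff D.skeleton D'.skeleton).card) :
    2 ^ (n - 1) - 2 ≤ D.dist D' := by
  classical
  have hcard' := hcard
  rw [card_edgeDiff_comm h h'] at hcard'
  have hdisj : Disjoint (edgeDiff D.skeleton D'.skeleton) (edgeDiff D'.skeleton D.skeleton) :=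
    Finset.disjoint_left.2 fun p hp hp' => (mem_edgeDiff.1 hp').2.2 (mem_edgeDiff.1 hp).2.1
  have h1 := sum_le_pairSum (D.pairDist D')
    (edgeDiff D.skeleton D'.skeleton ∪ edgeDiff D'.skeleton D.skeleton) (fun p hp => by
      rw [Finset.mem_union, mem_edgeDiff, mem_edgeDiff] at hp
      tauto)
  have h2 : (edgeDiff D.skeleton D'.skeleton ∪ edgeDiff D'.skeleton D.skeleton).card * 2 ^ (n - 3)
      ≤ ∑ p ∈ edgeDiff D.skeleton D'.skeleton ∪ edgeDiff D'.skeleton D.skeleton,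
        D.pairDist D' p.1 p.2 := by
    rw [← smul_eq_mul]
    refine Finset.card_nsmul_le_sum _ _ _ fun p hp => ?_
    rcases Finset.mem_union.1 hp with hp | hp
    · exact two_pow_le_pairDist_of_adj_diff hn h h' (mem_edgeDiff.1 hp).2.1
        (mem_edgeDiff.1 hp).2.2
    · rw [pairDist_symm]
      exact two_pow_le_pairDist_of_adj_diff hn h' h (mem_edgeDiff.1 hp).2.1
        (mem_edgeDiff.1 hp).2.2
  rw [Finset.card_union_of_disjoint hdisj] at h2
  have h3 : 4 * 2 ^ (n - 3) ≤ ((edgeDiff D.skeleton D'.skeleton).card +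
      (edgeDiff D'.skeleton D.skeleton).card) * 2 ^ (n - 3) :=
    Nat.mul_le_mul_right _ (by omega)
  have h4 : 2 ^ (n - 1) = 4 * 2 ^ (n - 3) := by
    rw [show n - 1 = n - 3 + 2 by omega, pow_add]; ring
  rw [dist_eq_pairSum]
  omega

theorem edgeDiff_eq_empty_iff {G G' : SimpleGraph (Fin n)} : edgeDiff G G' = ∅ ↔ G ≤ G' := by
  rw [Finset.eq_empty_iff_forall_notMem]
  constructor
  · intro h u v huv
    by_contra hcon
    rcases lt_or_gt_of_ne huv.ne with hlt | hlt
    · exact h (u, v) (mem_edgeDiff.2 ⟨hlt, huv, hcon⟩)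
    · exact h (v, u) (mem_edgeDiff.2 ⟨hlt, huv.symm, fun h' => hcon h'.symm⟩)
  · intro h p hp
    rw [mem_edgeDiff] at hp
    exact hp.2.2 (h hp.2.1)

theorem two_pow_le_dist_of_card_edgeDiff_eq_one (hn : 2 < n) (h : IsChainAlong D.skeleton σ)
    (h' : IsChainAlong D'.skeleton τ)
    (hcard : (edgeDiff D'.skeleton D.skeleton).card = 1) :
    2 ^ (n - 1) - 2 ≤ D.dist D' := by
  obtain ⟨⟨x, y⟩, hxy⟩ := Finset.card_eq_one.1 hcard
  have huniq : ∀ u v, D'.skeleton.Adj u v → ¬ D.skeleton.Adj u v →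
      (u = x ∧ v = y) ∨ (u = y ∧ v = x) := by
    intro u v h1 h2
    rcases lt_or_gt_of_ne h1.ne with hlt | hlt
    · have : (u, v) ∈ edgeDiff D'.skeleton D.skeleton := mem_edgeDiff.2 ⟨hlt, h1, h2⟩
      rw [hxy, Finset.mem_singleton, Prod.mk.injEq] at this
      exact Or.inl this
    · have : (v, u) ∈ edgeDiff D'.skeleton D.skeleton :=
        mem_edgeDiff.2 ⟨hlt, h1.symm, fun h3 => h2 h3.symm⟩
      rw [hxy, Finset.mem_singleton, Prod.mk.injEq] at this
      exact Or.inr this.symm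
  obtain ⟨hxy1, hxy2⟩ : D'.skeleton.Adj x y ∧ ¬ D.skeleton.Adj x y := by
    have : (x, y) ∈ edgeDiff D'.skeleton D.skeleton := by simp [hxy]
    exact (mem_edgeDiff.1 this).2
  -- Name the end points so that `x` precedes `y` along `τ`.
  clear hxy
  wlog hord : (τ.symm x : ℕ) + 1 = τ.symm y generalizing x y
  · exact this y x (fun u v h1 h2 => (huniq u v h1 h2).symm) hxy1.symm
      (fun h3 => hxy2 h3.symm) (((h'.adj_iff x y).1 hxy1).resolve_left hord)
  have hx : τ ⟨(τ.symm y : ℕ) - 1, by omega⟩ = x := by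
    rw [← Equiv.eq_symm_apply]; apply Fin.ext; simp only; omega
  refine two_pow_le_dist_of_single_jump hn h h' (k := τ.symm y) (by omega) (by omega) ?_ ?_
  · rw [hx]
    simpa using hxy2
  · intro t ht htk
    by_contra hcon
    have h1 : D'.skeleton.Adj (τ ⟨t, by omega⟩) (τ ⟨t + 1, ht⟩) := by
      rw [h']; left; rfl
    rcases huniq _ _ h1 hcon with ⟨h2, h3⟩ | ⟨h2, h3⟩
    · rw [← h3] at htk
      simp at htk
    · have hyt : (τ.symm y : ℕ) = t := by rw [← h2, Equiv.symm_apply_apply]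
      have hxt : (τ.symm x : ℕ) = t + 1 := by rw [← h3, Equiv.symm_apply_apply]
      omega

/-- Two chains that are not Markov equivalent are at distance at least `2 ^ (n - 1) - 2`. -/
theorem two_pow_le_dist (hn : 2 < n) (h : IsChainAlong D.skeleton σ)
    (h' : IsChainAlong D'.skeleton τ) (hne : ¬ D'.MarkovEquiv D) :
    2 ^ (n - 1) - 2 ≤ D.dist D' := by
  have hcomm := card_edgeDiff_comm h h'
  rcases (by omega : (edgeDiff D.skeleton D'.skeleton).card = 0 ∨
    (edgeDiff D.skeleton D'.skeleton).card = 1 ∨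
    2 ≤ (edgeDiff D.skeleton D'.skeleton).card) with h0 | h1 | h2
  · have heq : D.skeleton = D'.skeleton := le_antisymm
      (edgeDiff_eq_empty_iff.1 (Finset.card_eq_zero.1 h0))
      (edgeDiff_eq_empty_iff.1 (Finset.card_eq_zero.1 (hcomm ▸ h0)))
    exact two_pow_le_dist_of_skeleton_eq hn h (heq ▸ h) hne
  · exact two_pow_le_dist_of_card_edgeDiff_eq_one hn h h' (hcomm ▸ h1)
  · exact two_pow_le_dist_of_two_le_card_edgeDiff hn h h' h2

/-! ### The closest network -/

/-- The network obtained by copying the arcs between consecutive vertices of `σ`, except the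
first one, to the ordering `τ`, and letting the first arc point to the end of the chain. -/
def transportTail (D : BayesNet (Fin n)) (σ τ : Equiv.Perm (Fin n)) :
    BayesNet (Fin n) where
  Arc x y := (1 ≤ (τ.symm x : ℕ) ∧ 1 ≤ (τ.symm y : ℕ) ∧ D.Arc (σ (τ.symm x)) (σ (τ.symm y))) ∨
    ((τ.symm x : ℕ) = 1 ∧ (τ.symm y : ℕ) = 0)
  acyclic := by
    -- A directed path avoids the end vertex, except possibly as its last vertex.
    have key : ∀ x y : Fin n, Relation.TransGen
        (fun x y => (1 ≤ (τ.symm x : ℕ) ∧ 1 ≤ (τ.symm y : ℕ) ∧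
          D.Arc (σ (τ.symm x)) (σ (τ.symm y))) ∨
          ((τ.symm x : ℕ) = 1 ∧ (τ.symm y : ℕ) = 0)) x y →
        1 ≤ (τ.symm x : ℕ) ∧ ((τ.symm y : ℕ) = 0 ∨
          Relation.TransGen D.Arc (σ (τ.symm x)) (σ (τ.symm y))) := by
      intro x y hxy
      induction hxy with
      | single h =>
        rcases h with ⟨h1, -, h3⟩ | ⟨h1, h2⟩
        · exact ⟨h1, Or.inr (.single h3)⟩
        · exact ⟨h1.ge, Or.inl h2⟩
      | tail _ h ih =>
        refine ⟨ih.1, ?_⟩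
        rcases h with ⟨h1, -, h3⟩ | ⟨h1, h2⟩
        · exact Or.inr ((ih.2.resolve_left (by omega)).tail h3)
        · exact Or.inl h2
    intro v hv
    obtain ⟨h1, h2⟩ := key v v hv
    exact D.acyclic _ (h2.resolve_left (by omega))

theorem transportTail_arc (i j : Fin n) : (D.transportTail σ τ).Arc (τ i) (τ j) ↔
    (1 ≤ (i : ℕ) ∧ 1 ≤ (j : ℕ) ∧ D.Arc (σ i) (σ j)) ∨ ((i : ℕ) = 1 ∧ (j : ℕ) = 0) := by
  simp [transportTail]

theorem isChainAlong_transportTail (h : IsChainAlong D.skeleton σ) :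
    IsChainAlong (D.transportTail σ τ).skeleton τ := by
  intro i j
  have h1 : D.Arc (σ i) (σ j) ∨ D.Arc (σ j) (σ i) ↔ _ := h i j
  change (D.transportTail σ τ).Arc _ _ ∨ (D.transportTail σ τ).Arc _ _ ↔ _
  rw [transportTail_arc, transportTail_arc]
  constructor
  · rintro ((⟨-, -, h2⟩ | h2) | (⟨-, -, h2⟩ | h2))
    · exact h1.1 (Or.inl h2)
    · omega
    · exact h1.1 (Or.inr h2)
    · omega
  · intro h2
    rcases Nat.eq_zero_or_pos (i : ℕ) with hi | hi
    · exact Or.inr (Or.inr (by omega))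
    rcases Nat.eq_zero_or_pos (j : ℕ) with hj | hj
    · exact Or.inl (Or.inr (by omega))
    rcases h1.2 h2 with h3 | h3
    · exact Or.inl (Or.inl ⟨hi, hj, h3⟩)
    · exact Or.inr (Or.inl ⟨hj, hi, h3⟩)

theorem apply_mem_colliders_transportTail (h : IsChainAlong D.skeleton σ) (i : Fin n) :
    τ i ∈ (D.transportTail σ τ).colliders ↔ 2 ≤ (i : ℕ) ∧ σ i ∈ D.colliders := by
  have hadj : ∀ a b : Fin n, D.Arc (σ a) (σ b) → (a : ℕ) + 1 = b ∨ (b : ℕ) + 1 = a :=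
    fun a b hab => (h a b).1 (arc_adj hab)
  constructor
  · rintro ⟨u, w, huw, hu, hw⟩
    obtain ⟨a, rfl⟩ := τ.surjective u
    obtain ⟨b, rfl⟩ := τ.surjective w
    have hab : (a : ℕ) ≠ b := fun h' => huw (congrArg τ (Fin.ext h'))
    rw [transportTail_arc] at hu hw
    rcases hu with ⟨ha, hi, hu⟩ | hu
    · rcases hw with ⟨hb, -, hw⟩ | hw
      · have h1 := hadj _ _ hu
        have h2 := hadj _ _ hw
        exact ⟨by omega, σ a, σ b, fun h' => hab (congrArg Fin.val (σ.injective h')), hu, hw⟩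
      · omega
    · rcases hw with ⟨hb, hi, hw⟩ | hw <;> omega
  · rintro ⟨hi, u, w, huw, hu, hw⟩
    obtain ⟨a, rfl⟩ := σ.surjective u
    obtain ⟨b, rfl⟩ := σ.surjective w
    have h1 := hadj _ _ hu
    have h2 := hadj _ _ hw
    refine ⟨τ a, τ b, fun h' => huw (congrArg σ (τ.injective h')), ?_, ?_⟩
    · exact (transportTail_arc _ _).2 (Or.inl ⟨by omega, by omega, hu⟩)
    · exact (transportTail_arc _ _).2 (Or.inl ⟨by omega, by omega, hw⟩)

theorem symm_swap_trans_cases (hn : 2 ≤ n) (σ : Equiv.Perm (Fin n)) (w : Fin n) :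
    ((σ.symm w : ℕ) = 0 ∧ ((((Equiv.swap (⟨0, by omega⟩ : Fin n) ⟨1, by omega⟩).trans σ).symm w :
        Fin n) : ℕ) = 1) ∨
    ((σ.symm w : ℕ) = 1 ∧ ((((Equiv.swap (⟨0, by omega⟩ : Fin n) ⟨1, by omega⟩).trans σ).symm w :
        Fin n) : ℕ) = 0) ∨
    (2 ≤ (σ.symm w : ℕ) ∧ ((((Equiv.swap (⟨0, by omega⟩ : Fin n) ⟨1, by omega⟩).trans σ).symm w :
        Fin n) : ℕ) = σ.symm w) := by
  rw [Equiv.symm_trans_apply, Equiv.symm_swap]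
  rcases (by omega : (σ.symm w : ℕ) = 0 ∨ (σ.symm w : ℕ) = 1 ∨ 2 ≤ (σ.symm w : ℕ)) with h | h | h
  · left
    rw [show σ.symm w = ⟨0, by omega⟩ from Fin.ext h, Equiv.swap_apply_left]
    simp
  · right; left
    rw [show σ.symm w = ⟨1, by omega⟩ from Fin.ext h, Equiv.swap_apply_right]
    simp
  · right; right
    rw [Equiv.swap_apply_of_ne_of_ne (by rw [Ne, Fin.ext_iff]; simp only; omega)
      (by rw [Ne, Fin.ext_iff]; simp only; omega)]
    exact ⟨h, rfl⟩

theorem colliders_transportTail_swap (hn : 2 ≤ n) (h : IsChainAlong D.skeleton σ) :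
    (D.transportTail σ ((Equiv.swap (⟨0, by omega⟩ : Fin n) ⟨1, by omega⟩).trans σ)).colliders =
      D.colliders \ {σ ⟨1, by omega⟩} := by
  ext x
  have hc := symm_swap_trans_cases hn σ x
  set τ := (Equiv.swap (⟨0, by omega⟩ : Fin n) ⟨1, by omega⟩).trans σ
  have h1 := apply_mem_colliders_transportTail (τ := τ) h (τ.symm x)
  rw [Equiv.apply_symm_apply] at h1
  rw [h1, Set.mem_sdiff, Set.mem_singleton_iff, ← Equiv.symm_apply_eq, Fin.ext_iff]
  simp only
  constructor
  · rintro ⟨h2, h3⟩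
    have h4 : τ.symm x = σ.symm x := Fin.ext (by omega)
    rw [h4, Equiv.apply_symm_apply] at h3
    exact ⟨h3, by omega⟩
  · rintro ⟨h2, h3⟩
    have h5 := pos_of_mem_colliders h h2
    have h4 : τ.symm x = σ.symm x := Fin.ext (by omega)
    rw [h4, Equiv.apply_symm_apply]
    exact ⟨by omega, h2⟩

/-- If one path contains the other and the colliders agree along the shorter one, every
connecting set for the longer path is connecting for the shorter one. -/
theorem pairDist_add_of_subset (h : IsChainAlong D.skeleton σ)
    (h' : IsChainAlong D'.skeleton τ) {u v : Fin n}
    (hsub : pathSupport σ u v ⊆ pathSupport τ u v)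
    (hc : ∀ w ∈ pathSupport σ u v, w ≠ u → w ≠ v → (w ∈ D.colliders ↔ w ∈ D'.colliders)) :
    D.pairDist D' u v + 2 ^ (n - (pathSupport τ u v).card) =
      2 ^ (n - (pathSupport σ u v).card) := by
  have h1 := pairDist_add_inter D D' u v
  have h2 : D'.connecting u v ⊆ D.connecting u v := by
    rw [connecting_eq_agreeOn h, connecting_eq_agreeOn h']
    intro S hS
    rw [mem_agreeOn] at hS ⊢
    intro w hw
    have h3 := hS w (hsub hw)
    have h4 := hc w hw
    simp only [Set.mem_sdiff, Set.mem_insert_iff, Set.mem_singleton_iff] at h3 ⊢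
    tauto
  rw [Finset.inter_eq_right.2 h2, card_connecting h, card_connecting h'] at h1
  omega

/-- Only the pairs of one of the first two vertices with a later one contribute, and for each of
them one of the two paths contains the other. -/
theorem dist_eq_of_swap (hn : 2 < n) (h : IsChainAlong D.skeleton σ)
    (h' : IsChainAlong D'.skeleton
      ((Equiv.swap (⟨0, by omega⟩ : Fin n) ⟨1, by omega⟩).trans σ))
    (hc : D'.colliders = D.colliders \ {σ ⟨1, by omega⟩}) :
    D.dist D' = 2 ^ (n - 1) - 2 := by
  have hpos := symm_swap_trans_cases (by omega) σ
  set τ := (Equiv.swap (⟨0, by omega⟩ : Fin n) ⟨1, by omega⟩).trans σ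
  have hcol : ∀ w, (σ.symm w : ℕ) ≠ 1 → (w ∈ D.colliders ↔ w ∈ D'.colliders) := by
    intro w hw
    have : w ≠ σ ⟨1, by omega⟩ := by
      rintro rfl
      simp at hw
    rw [hc, Set.mem_sdiff, Set.mem_singleton_iff]
    tauto
  rw [dist_eq_pairSum_perm h h' σ]
  have hne : ∀ {w : Fin n} {i : Fin n}, w ≠ σ i → (σ.symm w : ℕ) ≠ i := by
    rintro w i hw h1
    exact hw ((Equiv.symm_apply_eq σ).1 (Fin.ext h1))
  refine pairSum_eq_of_tail (by omega) _ (fun j hj => ?_) (fun i j hij hor => ?_)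
  · have hpj := hpos (σ j)
    have hp0 := hpos (σ ⟨0, by omega⟩)
    have hp1 := hpos (σ ⟨1, by omega⟩)
    simp only [Equiv.symm_apply_apply] at hpj hp0 hp1
    have e0 : D.pairDist D' (σ ⟨0, by omega⟩) (σ j) = 2 ^ (n - (j + 1)) := by
      have e := pairDist_add_of_subset h' h (u := σ ⟨0, by omega⟩) (v := σ j) ?_ ?_
      · rw [card_pathSupport, card_pathSupport] at e
        simp only [Equiv.symm_apply_apply] at e
        rw [show ((j : ℤ) - ((0 : ℕ) : ℤ)).natAbs + 1 = j + 1 by omega,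
          show ((τ.symm (σ j) : ℤ) - τ.symm (σ ⟨0, by omega⟩)).natAbs + 1 = j by omega,
          show n - (j : ℕ) = n - (j + 1) + 1 by omega, pow_succ] at e
        rw [pairDist_symm]
        omega
      · intro w hw
        rw [mem_pathSupport] at hw ⊢
        have := hpos w
        simp only [Equiv.symm_apply_apply]
        omega
      · intro w hw _ _
        refine (hcol w ?_).symm
        rw [mem_pathSupport] at hw
        have := hpos w
        omega
    have e1 : D.pairDist D' (σ ⟨1, by omega⟩) (σ j) = 2 ^ (n - (j + 1)) := by
      have e := pairDist_add_of_subset h h' (u := σ ⟨1, by omega⟩) (v := σ j) ?_ ?_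
      · rw [card_pathSupport, card_pathSupport] at e
        simp only [Equiv.symm_apply_apply] at e
        rw [show ((j : ℤ) - ((1 : ℕ) : ℤ)).natAbs + 1 = j by omega,
          show ((τ.symm (σ j) : ℤ) - τ.symm (σ ⟨1, by omega⟩)).natAbs + 1 = j + 1 by omega,
          show n - (j : ℕ) = n - (j + 1) + 1 by omega, pow_succ] at e
        omega
      · intro w hw
        rw [mem_pathSupport] at hw ⊢
        have := hpos w
        simp only [Equiv.symm_apply_apply] at hw
        omega
      · intro w _ hw _
        exact hcol w (hne hw)
    rw [e0, e1, ← two_mul, ← pow_succ']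
    congr 1
    omega
  · have hpi := hpos (σ i)
    have hpj := hpos (σ j)
    simp only [Equiv.symm_apply_apply] at hpi hpj
    rw [Fin.lt_def] at hij
    have e := pairDist_add_of_subset h h' (u := σ i) (v := σ j) ?_ ?_
    · rw [card_pathSupport, card_pathSupport] at e
      simp only [Equiv.symm_apply_apply] at e
      rw [show ((τ.symm (σ j) : ℤ) - τ.symm (σ i)).natAbs = ((j : ℤ) - i).natAbs by omega] at e
      omega
    · intro w hw
      rw [mem_pathSupport] at hw ⊢
      have := hpos w
      simp only [Equiv.symm_apply_apply] at hw
      omega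
    · intro w hw h1 h2
      refine hcol w ?_
      have := hne h1
      have := hne h2
      rw [mem_pathSupport] at hw
      simp only [Equiv.symm_apply_apply] at hw
      omega

end BayesNet

theorem mainTheorem2 (n : ℕ) (hn : 3 ≤ n) (D : BayesNet (Fin n)) (hD : D.skeleton ∈ chains n) :
    IsLeast {d : ℕ | ∃ D' : BayesNet (Fin n),
        ¬ D'.MarkovEquiv D ∧ D'.skeleton ∈ chains n ∧ d = D.dist D'} (2 ^ (n - 1) - 2) ∧
    ∀ σ : Equiv.Perm (Fin n), IsChainAlong D.skeleton σ →
      ∃ D' : BayesNet (Fin n),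
        IsChainAlong D'.skeleton
          ((Equiv.swap (⟨0, by omega⟩ : Fin n) (⟨1, by omega⟩ : Fin n)).trans σ) ∧
        D'.colliders = D.colliders \ {σ ⟨1, by omega⟩} ∧
        BayesNet.IsClosest (chains n) D D' ∧
        D.dist D' = 2 ^ (n - 1) - 2 := by
  have hlower : ∀ D' : BayesNet (Fin n), ¬ D'.MarkovEquiv D → D'.skeleton ∈ chains n →
      2 ^ (n - 1) - 2 ≤ D.dist D' := by
    rintro D' hne ⟨τ, h'⟩
    obtain ⟨σ, h⟩ := hD
    exact BayesNet.two_pow_le_dist hn h h' hne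
  have hexists : ∀ σ : Equiv.Perm (Fin n), IsChainAlong D.skeleton σ →
      ∃ D' : BayesNet (Fin n),
        IsChainAlong D'.skeleton
          ((Equiv.swap (⟨0, by omega⟩ : Fin n) (⟨1, by omega⟩ : Fin n)).trans σ) ∧
        D'.colliders = D.colliders \ {σ ⟨1, by omega⟩} ∧
        ¬ D'.MarkovEquiv D ∧ D.dist D' = 2 ^ (n - 1) - 2 := by
    intro σ h
    have h' := BayesNet.isChainAlong_transportTail
      (τ := (Equiv.swap (⟨0, by omega⟩ : Fin n) (⟨1, by omega⟩ : Fin n)).trans σ) h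
    have hc := BayesNet.colliders_transportTail_swap (by omega) h
    have hd := BayesNet.dist_eq_of_swap hn h h' hc
    refine ⟨_, h', hc, fun hequiv => ?_, hd⟩
    have h0 := BayesNet.dist_eq_zero_of_markovEquiv hequiv
    have h4 : 2 ^ 2 ≤ 2 ^ (n - 1) := Nat.pow_le_pow_right (by norm_num) (by omega)
    omega
  refine ⟨⟨?_, ?_⟩, fun σ h => ?_⟩
  · obtain ⟨σ, h⟩ := hD
    obtain ⟨D', h', -, hne, hd⟩ := hexists σ h
    exact ⟨D', hne, ⟨_, h'⟩, hd.symm⟩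
  · rintro d ⟨D', hne, h', rfl⟩
    exact hlower D' hne h'
  · obtain ⟨D', h', hc, hne, hd⟩ := hexists σ h
    exact ⟨D', h', hc, ⟨⟨hne, _, h'⟩, fun D'' h'' => hd ▸ hlower D'' h''.1 h''.2⟩, hd⟩
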